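/- Let $d\ge 3$. For $n\ge 1$ let $X_1,\dots,X_n,Y_1,\dots,Y_n$ be $2n$ independent random points, each uniformly distributed on $[0,1]^d$, and let $$M_n=\min_{\varphi}\ \max_{1\le i\le n}\ \|X_i-Y_{\varphi(i)}\|_2,$$ the minimum being over all permutations $\varphi$ of $\{1,\dots,n\}$; thus $M_n$ is the weight of the bottleneck matching of the complete bipartite graph on $\{X_i\}$ and $\{Y_i\}$ with edges weighted by Euclidean distance. Let $r_c=r_c(n)=\left(\dfrac{\log n}{\pi_d\, n}\right)^{1/d}$, where $\pi_d$ is the volume of the unit ball in $\mathbb R^d$. Then there is a constant $c_d>0$, depending only on $d$, such that for every $\beta>1$ and every $n\ge 1$, $$\mathbb P\{M_n>c_d\,\beta\, r_c\}\ \le\ \frac{1}{n^{\beta^2-1}}.$$ Consequently $M_n=\mathcal O(r_c)$ with high probability, that is, there is a constant $C>0$, depending only on $d$, such that $\mathbb P\{M_n\le C\,r_c\}\to 1$ as $n\to\infty$. -/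

import Mathlib

open MeasureTheory Filter Topology

noncomputable section

/-- The cube `[0, 1]^d` in Euclidean space (the norm of the ambient space is the Euclidean one). -/
def unitCube (d : ℕ) : Set (EuclideanSpace ℝ (Fin d)) :=
  {x | ∀ k, x k ∈ Set.Icc (0 : ℝ) 1}

/-- The uniform distribution on `[0, 1]^d`; no normalisation is needed, the cube has volume `1`. -/
def uniformCube (d : ℕ) : Measure (EuclideanSpace ℝ (Fin d)) :=
  volume.restrict (unitCube d)

theorem volume_unitCube (d : ℕ) : volume (unitCube d) = 1 := by
  have h : unitCube d = (MeasurableEquiv.toLp 2 (Fin d → ℝ)).symm ⁻¹'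
      (Set.univ.pi fun _ => Set.Icc (0 : ℝ) 1) := by
    ext x
    simp [unitCube, Set.mem_pi, -Set.pi_univ_Icc]
  rw [h, (EuclideanSpace.volume_preserving_symm_measurableEquiv_toLp (Fin d)).measure_preimage_equiv,
    volume_pi_pi]
  simp

instance uniformCube_isProbabilityMeasure (d : ℕ) : IsProbabilityMeasure (uniformCube d) :=
  ⟨by simp [uniformCube, volume_unitCube]⟩

/-- The joint law of the two samples `S₁ = (x₁, …, xₙ)` and `S₂ = (y₁, …, yₙ)`: all `2n` points
are independent and uniform on `[0, 1]^d`. -/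
def bipartiteLaw (d n : ℕ) :
    Measure ((Fin n → EuclideanSpace ℝ (Fin d)) × (Fin n → EuclideanSpace ℝ (Fin d))) :=
  (Measure.pi fun _ => uniformCube d).prod (Measure.pi fun _ => uniformCube d)

instance bipartiteLaw_isProbabilityMeasure (d n : ℕ) :
    IsProbabilityMeasure (bipartiteLaw d n) := by
  unfold bipartiteLaw
  infer_instance

/-- The weight of the perfect matching `xᵢ ↦ y_{φ(i)}` of the complete bipartite graph whose edges
are weighted by Euclidean distance: the maximum weight of an edge in the matching. -/
def matchingWeight {d n : ℕ} (x y : Fin n → EuclideanSpace ℝ (Fin d))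
    (φ : Equiv.Perm (Fin n)) : ℝ :=
  ⨆ i, dist (x i) (y (φ i))

/-- The bottleneck matching weight `M_n`: the minimum of the weights of all perfect matchings. -/
def bottleneckWeight {d n : ℕ} (x y : Fin n → EuclideanSpace ℝ (Fin d)) : ℝ :=
  ⨅ φ : Equiv.Perm (Fin n), matchingWeight x y φ

/-- The critical radius `r_c = (log n / (π_d n))^{1/d}`, where `π_d` is the volume of the unit ball
of `ℝ^d`. -/
def criticalRadius (d n : ℕ) : ℝ :=
  (Real.log n / (volume.real (Metric.ball (0 : EuclideanSpace ℝ (Fin d)) 1) * n)) ^ (1 / (d : ℝ))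

end

/-! Bisect the cube cyclically along the axes and spread each sample point evenly over its box of
level `k`. Passing between levels `k` and `k + 1` only redistributes the mass of each box between
its two halves. If the counts of the halves have relative error at most `δ`, stretching along one
axis does this with displacement at most `side * δ`. At level `0` both samples become the same
measure, `n` times Lebesgue measure on the cube, so going from level `m` down to `0` with `x` and
back up with `y` connects them. Displacements are recorded as inequalities `mass A ≤ mass'
(closedNbhd r A)`, which compose and end in Hall's condition (`bottleneckWeight_le_of_balancedAt`).

By Chernoff's bound the relative error at level `k` is about `√(L * 2 ^ k / n)` outside probability
`exp (-L)` per box, while the sides are about `2 ^ (-k / d)`. Their product grows geometrically in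
`k` exactly when `d ≥ 3`, so the finest level, `2 ^ m ≈ n / L`, dominates and the total is of order
`(L / n) ^ (1 / d)` (`sum_dyadicSide_mul_sqrt_le`). Taking `L = 4 * β ^ 2 * log n` gives the
theorem. -/

/-! ### Neighbourhoods, boxes and axial stretching. -/

/-- The closed `r`-neighbourhood of `A`: all points at distance at most `r` from a point of `A`. -/
def closedNbhd {α : Type*} [PseudoMetricSpace α] (r : ℝ) (A : Set α) : Set α :=
  {y | ∃ x ∈ A, dist x y ≤ r}

theorem closedNbhd_mono {α : Type*} [PseudoMetricSpace α] {r : ℝ} {A B : Set α} (h : A ⊆ B) :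
    closedNbhd r A ⊆ closedNbhd r B :=
  fun _ ⟨x, hx, hr⟩ => ⟨x, h hx, hr⟩

theorem closedNbhd_closedNbhd_subset {α : Type*} [PseudoMetricSpace α] (r s : ℝ) (A : Set α) :
    closedNbhd s (closedNbhd r A) ⊆ closedNbhd (r + s) A := by
  rintro z ⟨y, ⟨x, hx, hr⟩, hs⟩
  exact ⟨x, hx, (dist_triangle x y z).trans (add_le_add hr hs)⟩

/-- The half-open box with lowest corner `lo` and side lengths `s`. -/
def coordBox {d : ℕ} (lo s : Fin d → ℝ) : Set (EuclideanSpace ℝ (Fin d)) :=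
  {x | ∀ i, x i ∈ Set.Ico (lo i) (lo i + s i)}

theorem coordBox_eq_preimage {d : ℕ} (lo s : Fin d → ℝ) :
    coordBox lo s = (MeasurableEquiv.toLp 2 (Fin d → ℝ)).symm ⁻¹'
      (Set.univ.pi fun i => Set.Ico (lo i) (lo i + s i)) := by
  ext x
  simp [coordBox, Set.mem_pi]

theorem measurableSet_coordBox {d : ℕ} (lo s : Fin d → ℝ) : MeasurableSet (coordBox lo s) := by
  rw [coordBox_eq_preimage]
  exact (MeasurableEquiv.toLp 2 (Fin d → ℝ)).symm.measurable
    (MeasurableSet.univ_pi fun _ => measurableSet_Ico)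

theorem volume_coordBox {d : ℕ} (lo s : Fin d → ℝ) (hs : ∀ i, 0 ≤ s i) :
    volume (coordBox lo s) = ENNReal.ofReal (∏ i, s i) := by
  rw [coordBox_eq_preimage,
    (EuclideanSpace.volume_preserving_symm_measurableEquiv_toLp (Fin d)).measure_preimage_equiv,
    volume_pi_pi, ENNReal.ofReal_prod_of_nonneg fun i _ => hs i]
  simp

theorem dist_le_of_mem_coordBox {d : ℕ} {lo s : Fin d → ℝ} {x y : EuclideanSpace ℝ (Fin d)}
    (hx : x ∈ coordBox lo s) (hy : y ∈ coordBox lo s) {t : ℝ} (ht : 0 ≤ t) (hs : ∀ i, s i ≤ t) :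
    dist x y ≤ d * t := by
  rw [EuclideanSpace.dist_eq]
  refine Real.sqrt_le_iff.2 ⟨by positivity, ?_⟩
  calc ∑ i, dist (x i) (y i) ^ 2 ≤ ∑ _i : Fin d, t ^ 2 := by
        gcongr with i
        have h1 := hx i
        have h2 := hy i
        have h3 := hs i
        rw [Set.mem_Ico] at h1 h2
        rw [Real.dist_eq, abs_le]
        constructor <;> linarith
    _ = d * t ^ 2 := by simp
    _ ≤ (d * t) ^ 2 := by
        have : (d : ℝ) ≤ d ^ 2 := by exact_mod_cast Nat.le_self_pow two_ne_zero d
        rw [mul_pow]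
        gcongr

/-- A set in a box can be stretched along one axis so as to lie in a prescribed box. -/
theorem exists_subset_closedNbhd_inter_coordBox {d : ℕ} {lo s : Fin d → ℝ} (j : Fin d) {u w r : ℝ}
    (hs : 0 < s j) (hw : 0 < w) (hlo : |lo j - u| ≤ r) (hhi : |lo j + s j - (u + w)| ≤ r)
    {B : Set (EuclideanSpace ℝ (Fin d))} (hB : B ⊆ coordBox lo s) :
    ∃ B' ⊆ closedNbhd r B ∩ coordBox (Function.update lo j u) (Function.update s j w),
      volume B' = ENNReal.ofReal (w / s j) * volume B := by
  set c := w / s j with hc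
  have hc0 : 0 < c := div_pos hw hs
  have hcs : c * s j = w := div_mul_cancel₀ _ hs.ne'
  -- The stretch by `c` along axis `j` is the identity plus a rank-one map, so its determinant is `1
  -- + (c - 1) = c`; the translation by `w'` then sends `lo j` to `u`.
  let e : EuclideanSpace ℝ (Fin d) := EuclideanSpace.single j 1
  let f : Module.Dual ℝ (EuclideanSpace ℝ (Fin d)) := (EuclideanSpace.proj j).toLinearMap
  let T := LinearMap.transvection f ((c - 1) • e)
  have hT : ∀ x, T x = x + (x j * (c - 1)) • e := fun x => by
    simp [T, f, LinearMap.transvection.apply, smul_smul]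
  have hdet : LinearMap.det T = c := by
    rw [LinearMap.transvection.det]
    simp [f, e]
  let w' := (u - c * lo j) • e
  refine ⟨(· + w') '' (T '' B), ?_, ?_⟩
  · rintro _ ⟨_, ⟨x, hx, rfl⟩, rfl⟩
    have hxj := (hB hx j)
    rw [Set.mem_Ico] at hxj
    have key : T x + w' = x + (u + c * (x j - lo j) - x j) • e := by
      rw [hT, add_assoc, ← add_smul]
      congr 2
      ring
    refine ⟨⟨x, hx, ?_⟩, fun i => ?_⟩
    · show dist x (T x + w') ≤ r
      rw [key, dist_eq_norm, sub_add_cancel_left, norm_neg, norm_smul]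
      simp only [e, PiLp.norm_single, norm_one, mul_one, Real.norm_eq_abs]
      have hl : 0 ≤ (x j - lo j) / s j := div_nonneg (by linarith) hs.le
      have hl1 : (x j - lo j) / s j ≤ 1 := (div_le_one hs).2 (by linarith)
      set l := (x j - lo j) / s j
      have hxl : x j = lo j + l * s j := by simp [l, hs.ne']
      -- The displacement is a convex combination of those of the two end faces, each at most `r`.
      have : u + c * (x j - lo j) - x j
          = (1 - l) * (u - lo j) + l * (u + w - (lo j + s j)) := by
        rw [hxl, ← hcs]; ring
      rw [this]
      rw [abs_le] at *
      constructor <;> nlinarith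
    · show (T x + w') i ∈ _
      rw [key]
      rcases eq_or_ne i j with rfl | hij
      · have h1 : 0 ≤ c * (x i - lo i) := mul_nonneg hc0.le (by linarith)
        have h2 : c * (x i - lo i) < w := by
          rw [← hcs]; exact mul_lt_mul_of_pos_left (by linarith) hc0
        simp [e]
        constructor <;> linarith
      · simpa [e, hij] using hB hx i
  · rw [Set.image_add_right, measure_preimage_add_right, Measure.addHaar_image_linearMap, hdet,
      abs_of_pos hc0]

/-- Stretching multiplies volume by `w / s j`, and `hαγ` says that the density drops by no more than
this factor. -/
theorem mul_volume_le_mul_volume_closedNbhd {d : ℕ} {lo s : Fin d → ℝ} (j : Fin d) {u w r α γ : ℝ}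
    (hs : 0 < s j) (hw : 0 < w) (hlo : |lo j - u| ≤ r) (hhi : |lo j + s j - (u + w)| ≤ r)
    (hγ : 0 ≤ γ) (hαγ : α * s j ≤ γ * w) {B A : Set (EuclideanSpace ℝ (Fin d))}
    (hBA : B ⊆ A) (hB : B ⊆ coordBox lo s) :
    ENNReal.ofReal α * volume B ≤ ENNReal.ofReal γ *
      volume (closedNbhd r A ∩ coordBox (Function.update lo j u) (Function.update s j w)) := by
  obtain ⟨B', hB', hv⟩ := exists_subset_closedNbhd_inter_coordBox j hs hw hlo hhi hB
  calc ENNReal.ofReal α * volume B ≤ ENNReal.ofReal (γ * (w / s j)) * volume B := by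
        gcongr
        rw [← mul_div_assoc, le_div_iff₀ hs]
        exact hαγ
    _ = ENNReal.ofReal γ * volume B' := by rw [hv, ENNReal.ofReal_mul hγ, mul_assoc]
    _ ≤ _ := by
        gcongr
        exact hB'.trans (Set.inter_subset_inter_left _ (closedNbhd_mono hBA))

/-- The lower part of a box, cut at height `lo j + t` along the axis `j`. -/
theorem coordBox_inter_lt {d : ℕ} (lo s : Fin d → ℝ) (j : Fin d) {t : ℝ} (ht : t ≤ s j) :
    coordBox lo s ∩ {x | x j < lo j + t} = coordBox lo (Function.update s j t) := by
  ext x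
  simp only [coordBox, Set.mem_inter_iff, Set.mem_ofPred_eq, Set.mem_Ico]
  constructor
  · rintro ⟨h, h'⟩ i
    rcases eq_or_ne i j with rfl | hij
    · simpa using ⟨(h i).1, h'⟩
    · simpa [hij] using h i
  · intro h
    refine ⟨fun i => ?_, by simpa using (h j).2⟩
    rcases eq_or_ne i j with rfl | hij
    · have := h i
      simp only [Function.update_self] at this
      exact ⟨this.1, by linarith⟩
    · simpa [hij] using h i

/-- The upper part of a box, cut at height `lo j + t` along the axis `j`. -/
theorem coordBox_inter_not_lt {d : ℕ} (lo s : Fin d → ℝ) (j : Fin d) {t : ℝ} (ht : 0 ≤ t) :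
    coordBox lo s \ {x | x j < lo j + t} =
      coordBox (Function.update lo j (lo j + t)) (Function.update s j (s j - t)) := by
  ext x
  simp only [coordBox, Set.mem_sdiff, Set.mem_ofPred_eq, Set.mem_Ico, not_lt]
  constructor
  · rintro ⟨h, h'⟩ i
    rcases eq_or_ne i j with rfl | hij
    · have := h i
      simp only [Function.update_self]
      exact ⟨h', by linarith⟩
    · simpa [hij] using h i
  · intro h
    have hj := h j
    simp only [Function.update_self] at hj
    refine ⟨fun i => ?_, hj.1⟩
    rcases eq_or_ne i j with rfl | hij
    · exact ⟨by linarith, by linarith⟩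
    · simpa [hij] using h i

theorem measurableSet_coord_lt {d : ℕ} (j : Fin d) (t : ℝ) :
    MeasurableSet {x : EuclideanSpace ℝ (Fin d) | x j < t} :=
  measurableSet_lt (by fun_prop) measurable_const

/-- Only the cutting half-space has to be measurable, so `A` is arbitrary; neighbourhoods thus need
no measurability proof. -/
theorem volume_inter_coordBox_add {d : ℕ} (lo s : Fin d → ℝ) (j : Fin d) {t : ℝ} (ht : 0 ≤ t)
    (hts : t ≤ s j) (A : Set (EuclideanSpace ℝ (Fin d))) :
    volume (A ∩ coordBox lo (Function.update s j t)) + volume (A ∩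
      coordBox (Function.update lo j (lo j + t)) (Function.update s j (s j - t))) =
    volume (A ∩ coordBox lo s) := by
  rw [← coordBox_inter_lt lo s j hts, ← coordBox_inter_not_lt lo s j ht,
    ← measure_inter_add_sdiff (A ∩ coordBox lo s) (measurableSet_coord_lt j (lo j + t)),
    Set.inter_assoc, Set.inter_sdiff_assoc]

/-- Replacing the density `α` of a box by the densities `2 * γ₁`, `2 * γ₂` of its two halves, where
`γ₁ + γ₂ = α`, moves mass by at most the length of the halved side times `|γ₁ / α - 1 / 2|`. -/
theorem mul_volume_le_halves {d : ℕ} {lo s : Fin d → ℝ} (j : Fin d) {r γ₁ γ₂ : ℝ} (hs : 0 < s j)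
    (h₁ : 0 < γ₁) (h₂ : 0 < γ₂) (hr : s j * |γ₁ / (γ₁ + γ₂) - 1 / 2| ≤ r)
    (A : Set (EuclideanSpace ℝ (Fin d))) :
    ENNReal.ofReal (γ₁ + γ₂) * volume (A ∩ coordBox lo s) ≤
      ENNReal.ofReal (2 * γ₁) *
        volume (closedNbhd r A ∩ coordBox lo (Function.update s j (s j / 2))) +
      ENNReal.ofReal (2 * γ₂) * volume (closedNbhd r A ∩
        coordBox (Function.update lo j (lo j + s j / 2)) (Function.update s j (s j / 2))) := by
  set p := γ₁ / (γ₁ + γ₂)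
  have hp : 0 < p := by positivity
  have hp1 : p < 1 := (div_lt_one (by linarith)).2 (by linarith)
  have hγ₁ : (γ₁ + γ₂) * p = γ₁ := by simp only [p]; field_simp
  have hγ₂ : (γ₁ + γ₂) * (1 - p) = γ₂ := by rw [mul_sub, hγ₁]; ring
  have hr0 : 0 ≤ r := le_trans (by positivity) hr
  have hr' : |p * s j - s j / 2| ≤ r := by
    have : p * s j - s j / 2 = s j * (p - 1 / 2) := by ring
    rwa [this, abs_mul, abs_of_pos hs]
  -- Cut at the fraction `p`: at density `γ₁ + γ₂` the two full pieces carry the masses of the two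
  -- halves at densities `2 * γ₁` and `2 * γ₂`. Each piece is stretched onto its half; only the
  -- cutting face moves.
  rw [← volume_inter_coordBox_add lo s j (t := p * s j) (by positivity) (by nlinarith) A, mul_add]
  gcongr ?_ + ?_
  · have := mul_volume_le_mul_volume_closedNbhd (lo := lo) (s := Function.update s j (p * s j)) j
      (u := lo j) (w := s j / 2) (r := r) (α := γ₁ + γ₂) (γ := 2 * γ₁) (by simp; positivity)
      (by positivity) (by simpa using hr0) (by simpa using hr') (by positivity)
      (by simp; linear_combination (s j) * hγ₁) (A := A) Set.inter_subset_left
      Set.inter_subset_right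
    simpa using this
  · have := mul_volume_le_mul_volume_closedNbhd (lo := Function.update lo j (lo j + p * s j))
      (s := Function.update s j (s j - p * s j)) j
      (u := lo j + s j / 2) (w := s j / 2) (r := r) (α := γ₁ + γ₂) (γ := 2 * γ₂)
      (by simp; nlinarith)
      (by positivity) (by simpa using hr') (by simpa [add_assoc] using hr0) (by positivity)
      (by simp; linear_combination (s j) * hγ₂) (A := A) Set.inter_subset_left
      Set.inter_subset_right
    simpa using this

/-- The converse of `mul_volume_le_halves`. -/
theorem halves_le_mul_volume {d : ℕ} {lo s : Fin d → ℝ} (j : Fin d) {r γ₁ γ₂ : ℝ} (hs : 0 < s j)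
    (h₁ : 0 < γ₁) (h₂ : 0 < γ₂) (hr : s j * |γ₁ / (γ₁ + γ₂) - 1 / 2| ≤ r)
    (A : Set (EuclideanSpace ℝ (Fin d))) :
    ENNReal.ofReal (2 * γ₁) * volume (A ∩ coordBox lo (Function.update s j (s j / 2))) +
      ENNReal.ofReal (2 * γ₂) * volume (A ∩
        coordBox (Function.update lo j (lo j + s j / 2)) (Function.update s j (s j / 2))) ≤
    ENNReal.ofReal (γ₁ + γ₂) * volume (closedNbhd r A ∩ coordBox lo s) := by
  set p := γ₁ / (γ₁ + γ₂)
  have hp : 0 < p := by positivity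
  have hp1 : p < 1 := (div_lt_one (by linarith)).2 (by linarith)
  have hγ₁ : (γ₁ + γ₂) * p = γ₁ := by simp only [p]; field_simp
  have hγ₂ : (γ₁ + γ₂) * (1 - p) = γ₂ := by rw [mul_sub, hγ₁]; ring
  have hr0 : 0 ≤ r := le_trans (by positivity) hr
  have hr' : |s j / 2 - p * s j| ≤ r := by
    have : s j / 2 - p * s j = - (s j * (p - 1 / 2)) := by ring
    rwa [this, abs_neg, abs_mul, abs_of_pos hs]
  rw [← volume_inter_coordBox_add lo s j (t := p * s j) (by positivity) (by nlinarith)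
    (closedNbhd r A), mul_add]
  gcongr ?_ + ?_
  · have := mul_volume_le_mul_volume_closedNbhd (lo := lo) (s := Function.update s j (s j / 2)) j
      (u := lo j) (w := p * s j) (r := r) (α := 2 * γ₁) (γ := γ₁ + γ₂) (by simp; positivity)
      (by positivity) (by simpa using hr0) (by simpa using hr') (by positivity)
      (by simp; linear_combination -(s j) * hγ₁) (A := A) Set.inter_subset_left
      Set.inter_subset_right
    simpa using this
  · have := mul_volume_le_mul_volume_closedNbhd (lo := Function.update lo j (lo j + s j / 2))
      (s := Function.update s j (s j / 2)) j
      (u := lo j + p * s j) (w := s j - p * s j) (r := r) (α := 2 * γ₂) (γ := γ₁ + γ₂)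
      (by simp; positivity)
      (by nlinarith) (by simpa using hr') (by simpa [add_assoc] using hr0) (by positivity)
      (by simp; linear_combination -(s j) * hγ₂) (A := A) Set.inter_subset_left
      Set.inter_subset_right
    simpa using this

/-! ### Dyadic boxes. -/

/-- The side lengths of a box obtained from the unit cube by `k` bisections along the coordinate
axes, taken in cyclic order. -/
noncomputable def dyadicSide (d : ℕ) [NeZero d] : ℕ → Fin d → ℝ
  | 0 => fun _ => 1
  | k + 1 => Function.update (dyadicSide d k) (Fin.ofNat d k) (dyadicSide d k (Fin.ofNat d k) / 2)

/-- The lowest corner of the `v`-th box after `k` bisections; the halves of the box `v` are the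
boxes `2 * v` and `2 * v + 1` of the next level. -/
noncomputable def dyadicCorner (d : ℕ) [NeZero d] : ℕ → ℕ → Fin d → ℝ
  | 0, _ => fun _ => 0
  | k + 1, v =>
    if v % 2 = 0 then dyadicCorner d k (v / 2)
    else Function.update (dyadicCorner d k (v / 2)) (Fin.ofNat d k)
      (dyadicCorner d k (v / 2) (Fin.ofNat d k) + dyadicSide d k (Fin.ofNat d k) / 2)

/-- The `v`-th box after `k` bisections of the unit cube. -/
def dyadicBox (d : ℕ) [NeZero d] (k v : ℕ) : Set (EuclideanSpace ℝ (Fin d)) :=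
  coordBox (dyadicCorner d k v) (dyadicSide d k)

section dyadic

variable {d : ℕ} [NeZero d]

theorem dyadicBox_zero (v : ℕ) : dyadicBox d 0 v = coordBox (fun _ => 0) fun _ => 1 := rfl

theorem dyadicBox_succ_even (k v : ℕ) : dyadicBox d (k + 1) (2 * v) =
    coordBox (dyadicCorner d k v) (Function.update (dyadicSide d k) (Fin.ofNat d k)
      (dyadicSide d k (Fin.ofNat d k) / 2)) := by
  simp [dyadicBox, dyadicCorner, dyadicSide]

theorem dyadicBox_succ_odd (k v : ℕ) : dyadicBox d (k + 1) (2 * v + 1) =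
    coordBox (Function.update (dyadicCorner d k v) (Fin.ofNat d k)
        (dyadicCorner d k v (Fin.ofNat d k) + dyadicSide d k (Fin.ofNat d k) / 2))
      (Function.update (dyadicSide d k) (Fin.ofNat d k)
        (dyadicSide d k (Fin.ofNat d k) / 2)) := by
  have h : (2 * v + 1) / 2 = v := by omega
  simp [dyadicBox, dyadicCorner, dyadicSide, h, Nat.add_mod]

theorem dyadicSide_pos (k : ℕ) (i : Fin d) : 0 < dyadicSide d k i := by
  induction k generalizing i with
  | zero => simp [dyadicSide]
  | succ k ih =>
    rw [dyadicSide]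
    rcases eq_or_ne i (Fin.ofNat d k) with rfl | hi
    · simpa using ih _
    · simpa only [Function.update_of_ne hi] using ih i

theorem prod_dyadicSide (k : ℕ) : ∏ i, dyadicSide d k i = (1 / 2) ^ k := by
  induction k with
  | zero => simp [dyadicSide]
  | succ k ih =>
    rw [dyadicSide, Finset.prod_update_of_mem (Finset.mem_univ _), pow_succ, ← ih,
      ← Finset.mul_prod_erase _ _ (Finset.mem_univ (Fin.ofNat d k)), Finset.sdiff_singleton_eq_erase]
    ring

theorem volume_dyadicBox (k v : ℕ) :
    volume (dyadicBox d k v) = ENNReal.ofReal ((1 / 2) ^ k) := by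
  rw [dyadicBox, volume_coordBox _ _ fun i => (dyadicSide_pos k i).le, prod_dyadicSide]

theorem measurableSet_dyadicBox (k v : ℕ) : MeasurableSet (dyadicBox d k v) :=
  measurableSet_coordBox _ _

theorem dyadicBox_succ_even_eq (k v : ℕ) : dyadicBox d (k + 1) (2 * v) = dyadicBox d k v ∩
    {x | x (Fin.ofNat d k) <
      dyadicCorner d k v (Fin.ofNat d k) + dyadicSide d k (Fin.ofNat d k) / 2} := by
  rw [dyadicBox_succ_even, dyadicBox, coordBox_inter_lt]
  linarith [dyadicSide_pos k (Fin.ofNat d k)]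

theorem dyadicBox_succ_odd_eq (k v : ℕ) : dyadicBox d (k + 1) (2 * v + 1) = dyadicBox d k v \
    {x | x (Fin.ofNat d k) <
      dyadicCorner d k v (Fin.ofNat d k) + dyadicSide d k (Fin.ofNat d k) / 2} := by
  rw [dyadicBox_succ_odd, dyadicBox, coordBox_inter_not_lt, sub_half]
  linarith [dyadicSide_pos k (Fin.ofNat d k)]

theorem dyadicBox_subset (k v : ℕ) : dyadicBox d k v ⊆ coordBox (fun _ => 0) fun _ => 1 := by
  induction k generalizing v with
  | zero => exact (dyadicBox_zero v).le
  | succ k ih =>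
    obtain ⟨w, rfl | rfl⟩ := Nat.even_or_odd' v
    · rw [dyadicBox_succ_even_eq]
      exact Set.inter_subset_left.trans (ih w)
    · rw [dyadicBox_succ_odd_eq]
      exact Set.sdiff_subset.trans (ih w)

/-- The exponent counts the steps `j < k` with `j ≡ i` modulo `d`, those which halve axis `i`. -/
theorem dyadicSide_le_pow_div (k : ℕ) (i : Fin d) :
    dyadicSide d k i ≤ (1 / 2) ^ ((k + (d - 1 - i)) / d) := by
  have hi := i.isLt
  induction k with
  | zero =>
    rw [Nat.div_eq_of_lt (by omega)]
    simp [dyadicSide]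
  | succ k ih =>
    rw [dyadicSide, show k + 1 + (d - 1 - i) = k + (d - 1 - i) + 1 by ring, Nat.succ_div]
    rcases eq_or_ne i (Fin.ofNat d k) with h | h
    · rw [← h, Function.update_self]
      have : (1 / 2 : ℝ) ^ ((k + (d - 1 - i)) / d + if d ∣ k + (d - 1 - i) + 1 then 1 else 0)
          ≥ (1 / 2 : ℝ) ^ ((k + (d - 1 - i)) / d + 1) := by
        apply pow_le_pow_of_le_one (by norm_num) (by norm_num)
        split_ifs <;> omega
      refine le_trans ?_ this
      rw [pow_succ]
      linarith
    · rw [Function.update_of_ne h, if_neg, add_zero]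
      · exact ih
      · rintro ⟨q, hq⟩
        apply h
        ext
        have : k + d = d * q + i := by omega
        have h2 : (k + d) % d = i := by rw [this, Nat.mul_add_mod, Nat.mod_eq_of_lt hi]
        simpa using h2.symm

/-- The factor `2` pays for an incomplete round of bisections. -/
theorem dyadicSide_le {θ : ℝ} (h0 : 0 ≤ θ) (h1 : θ ≤ 1) (hθ : θ ^ d = 1 / 2) (k : ℕ) (i : Fin d) :
    dyadicSide d k i ≤ 2 * θ ^ k := by
  have hd : 0 < d := Nat.pos_of_neZero d
  calc dyadicSide d k i ≤ (1 / 2) ^ ((k + (d - 1 - i)) / d) := dyadicSide_le_pow_div k i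
    _ ≤ (1 / 2) ^ (k / d) := by
        apply pow_le_pow_of_le_one (by norm_num) (by norm_num)
        exact Nat.div_le_div_right (by omega)
    _ = 2 * (θ ^ (d * (k / d)) * θ ^ d) := by rw [hθ, pow_mul, hθ]; ring
    _ ≤ 2 * θ ^ k := by
        rw [← pow_add]
        gcongr 2 * ?_
        apply pow_le_pow_of_le_one h0 h1
        have := Nat.div_add_mod k d
        have := Nat.mod_lt k hd
        omega

/-! ### Counts and spread masses. -/

open Classical in
/-- The number of points of the sample `x` in the box `v` of level `k`. -/
noncomputable def boxCount {n : ℕ} (x : Fin n → EuclideanSpace ℝ (Fin d)) (k v : ℕ) : ℕ :=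
  (Finset.univ.filter fun i => x i ∈ dyadicBox d k v).card

theorem sum_range_two_mul {M : Type*} [AddCommMonoid M] (f : ℕ → M) (N : ℕ) :
    ∑ v ∈ Finset.range (2 * N), f v = ∑ v ∈ Finset.range N, (f (2 * v) + f (2 * v + 1)) := by
  induction N with
  | zero => simp
  | succ N ih =>
    rw [mul_add, mul_one, Finset.sum_range_succ, Finset.sum_range_succ, ih, Finset.sum_range_succ,
      add_assoc]

open Classical in
theorem card_filter_inter_dyadicBox {n : ℕ} (x : Fin n → EuclideanSpace ℝ (Fin d))
    (A : Set (EuclideanSpace ℝ (Fin d))) (k v : ℕ) :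
    (Finset.univ.filter fun i => x i ∈ A ∧ x i ∈ dyadicBox d k v).card =
    (Finset.univ.filter fun i => x i ∈ A ∧ x i ∈ dyadicBox d (k + 1) (2 * v)).card +
    (Finset.univ.filter fun i => x i ∈ A ∧ x i ∈ dyadicBox d (k + 1) (2 * v + 1)).card := by
  rw [dyadicBox_succ_even_eq, dyadicBox_succ_odd_eq,
    ← Finset.card_filter_add_card_filter_not (s := Finset.univ.filter _) (fun i => x i (Fin.ofNat d k) <
      dyadicCorner d k v (Fin.ofNat d k) + dyadicSide d k (Fin.ofNat d k) / 2), Finset.filter_filter,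
    Finset.filter_filter]
  simp only [Set.mem_inter_iff, Set.mem_sdiff, Set.mem_ofPred_eq, and_assoc]

theorem boxCount_eq_add {n : ℕ} (x : Fin n → EuclideanSpace ℝ (Fin d)) (k v : ℕ) :
    boxCount x k v = boxCount x (k + 1) (2 * v) + boxCount x (k + 1) (2 * v + 1) := by
  unfold boxCount
  refine Eq.trans ?_ ((card_filter_inter_dyadicBox x Set.univ k v).trans ?_)
  · exact congrArg Finset.card (by ext i; simp)
  · exact congrArg₂ (fun s t : Finset (Fin n) => s.card + t.card) (by ext i; simp) (by ext i; simp)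

open Classical in
theorem card_filter_eq_sum_range {n : ℕ} {x : Fin n → EuclideanSpace ℝ (Fin d)}
    (hx : ∀ i, x i ∈ dyadicBox d 0 0) (A : Set (EuclideanSpace ℝ (Fin d))) (k : ℕ) :
    (Finset.univ.filter fun i => x i ∈ A).card = ∑ v ∈ Finset.range (2 ^ k),
      (Finset.univ.filter fun i => x i ∈ A ∧ x i ∈ dyadicBox d k v).card := by
  induction k with
  | zero => simp [hx]
  | succ k ih =>
    rw [ih, pow_succ', sum_range_two_mul]
    exact Finset.sum_congr rfl fun v _ => card_filter_inter_dyadicBox x A k v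

/-- The mass given to `A` when each point of the sample `x` is spread evenly over its box of
level `k`. -/
noncomputable def boxMass {n : ℕ} (x : Fin n → EuclideanSpace ℝ (Fin d)) (k : ℕ)
    (A : Set (EuclideanSpace ℝ (Fin d))) : ENNReal :=
  ∑ v ∈ Finset.range (2 ^ k),
    ENNReal.ofReal (2 ^ k * boxCount x k v) * volume (A ∩ dyadicBox d k v)

theorem boxMass_mono {n : ℕ} (x : Fin n → EuclideanSpace ℝ (Fin d)) (k : ℕ)
    {A B : Set (EuclideanSpace ℝ (Fin d))} (h : A ⊆ B) : boxMass x k A ≤ boxMass x k B := by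
  unfold boxMass
  gcongr

theorem ofReal_mul_volume_dyadicBox {n : ℕ} (x : Fin n → EuclideanSpace ℝ (Fin d)) (k v : ℕ) :
    ENNReal.ofReal (2 ^ k * boxCount x k v) * volume (dyadicBox d k v) = boxCount x k v := by
  rw [volume_dyadicBox, ← ENNReal.ofReal_mul (by positivity), mul_right_comm, ← mul_pow]
  simp

open Classical in
-- A box with a sample point in `A` lies wholly in the neighbourhood, so all its mass counts there.
theorem card_filter_le_boxMass {n : ℕ} {x : Fin n → EuclideanSpace ℝ (Fin d)}
    (hx : ∀ i, x i ∈ dyadicBox d 0 0) (A : Set (EuclideanSpace ℝ (Fin d))) {k : ℕ} {t : ℝ}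
    (ht : ∀ i, dyadicSide d k i ≤ t) :
    ((Finset.univ.filter fun i => x i ∈ A).card : ENNReal) ≤ boxMass x k (closedNbhd (d * t) A) := by
  have ht0 : 0 ≤ t := (dyadicSide_pos k 0).le.trans (ht 0)
  rw [card_filter_eq_sum_range hx A k, boxMass, Nat.cast_sum]
  gcongr with v
  by_cases h : ∃ i, x i ∈ A ∧ x i ∈ dyadicBox d k v
  · obtain ⟨i, hiA, hi⟩ := h
    rw [Set.inter_eq_right.2, ofReal_mul_volume_dyadicBox]
    · rw [boxCount]
      gcongr
      exact fun h => h.2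
    · exact fun y hy => ⟨x i, hiA, dist_le_of_mem_coordBox hi hy ht0 ht⟩
  · rw [Finset.filter_false_of_mem fun i _ hi => h ⟨i, hi⟩]
    simp

open Classical in
theorem boxMass_le_card_filter {n : ℕ} {x : Fin n → EuclideanSpace ℝ (Fin d)}
    (hx : ∀ i, x i ∈ dyadicBox d 0 0) (A : Set (EuclideanSpace ℝ (Fin d))) {k : ℕ} {t : ℝ}
    (ht : ∀ i, dyadicSide d k i ≤ t) :
    boxMass x k A ≤ ((Finset.univ.filter fun i => x i ∈ closedNbhd (d * t) A).card : ENNReal) := by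
  have ht0 : 0 ≤ t := (dyadicSide_pos k 0).le.trans (ht 0)
  rw [card_filter_eq_sum_range hx _ k, boxMass, Nat.cast_sum]
  gcongr with v
  rcases (A ∩ dyadicBox d k v).eq_empty_or_nonempty with h | ⟨z, hzA, hz⟩
  · simp [h]
  · refine (mul_le_mul_right (measure_mono Set.inter_subset_right) _).trans ?_
    rw [ofReal_mul_volume_dyadicBox, boxCount]
    gcongr with i
    intro hi
    exact ⟨⟨z, hzA, dist_le_of_mem_coordBox hz hi ht0 ht⟩, hi⟩

theorem boxCount_zero {n : ℕ} {x : Fin n → EuclideanSpace ℝ (Fin d)}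
    (hx : ∀ i, x i ∈ dyadicBox d 0 0) : boxCount x 0 0 = n := by
  simp [boxCount, hx]

/-- The right side does not depend on the sample: this is where `x` and `y` are compared. -/
theorem boxMass_zero {n : ℕ} {x : Fin n → EuclideanSpace ℝ (Fin d)}
    (hx : ∀ i, x i ∈ dyadicBox d 0 0) (A : Set (EuclideanSpace ℝ (Fin d))) :
    boxMass x 0 A = n * volume (A ∩ dyadicBox d 0 0) := by
  simp [boxMass, boxCount_zero hx]

/-! ### Balanced samples, transport between levels, and Hall's theorem. -/

/-- All boxes of level `k` hold their expected number of points, up to the relative error `δ`. -/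
def BalancedAt {n : ℕ} (x : Fin n → EuclideanSpace ℝ (Fin d)) (k : ℕ) (δ : ℝ) : Prop :=
  ∀ v < 2 ^ k, |boxCount x k v - (n : ℝ) / 2 ^ k| ≤ δ * ((n : ℝ) / 2 ^ k)

theorem BalancedAt.boxCount_pos {n : ℕ} (hn : 0 < n) {x : Fin n → EuclideanSpace ℝ (Fin d)}
    {k : ℕ} {δ : ℝ} (h : BalancedAt x k δ) (hδ : δ ≤ 1 / 2) {v : ℕ} (hv : v < 2 ^ k) :
    0 < (boxCount x k v : ℝ) := by
  have h1 := h v hv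
  have h2 : 0 < (n : ℝ) / 2 ^ k := by positivity
  rw [abs_le] at h1
  nlinarith

/-- With counts `a`, `b` and mean `N`, the difference is `(a - b) / (2 * (a + b))`, where `|a - b| ≤
2 * δ * N` and, as `δ ≤ 1 / 2`, `N ≤ a + b`. The common factor `c` lets the counts enter as
densities. -/
theorem BalancedAt.abs_div_sub_half_le {n : ℕ} (hn : 0 < n)
    {x : Fin n → EuclideanSpace ℝ (Fin d)} {k : ℕ} {δ : ℝ} (h : BalancedAt x k δ)
    (hδ : δ ≤ 1 / 2) {v w : ℕ} (hv : v < 2 ^ k) (hw : w < 2 ^ k) (c : ℝ) (hc : 0 < c) :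
    |c * (boxCount x k v : ℝ) / (c * boxCount x k v + c * boxCount x k w) - 1 / 2| ≤ δ := by
  have h1 := h v hv
  have h2 := h w hw
  have h3 := h.boxCount_pos hn hδ hv
  have h4 := h.boxCount_pos hn hδ hw
  have h5 : 0 < (n : ℝ) / 2 ^ k := by positivity
  set a : ℝ := (boxCount x k v : ℝ)
  set b : ℝ := (boxCount x k w : ℝ)
  set N := (n : ℝ) / 2 ^ k
  rw [abs_le] at h1 h2
  have hδ0 : 0 ≤ δ := by nlinarith
  have : c * a / (c * a + c * b) - 1 / 2 = (a - b) / (2 * (a + b)) := by field_simp; ring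
  rw [this, abs_div, abs_of_pos (by positivity : 0 < 2 * (a + b)), div_le_iff₀ (by positivity),
    abs_le]
  have : δ * N ≤ δ * (a + b) := by nlinarith
  constructor <;> linarith

theorem BalancedAt.boxMass_le_succ {n : ℕ} (hn : 0 < n) {x : Fin n → EuclideanSpace ℝ (Fin d)}
    {k : ℕ} {δ : ℝ} (h : BalancedAt x (k + 1) δ) (hδ : δ ≤ 1 / 2)
    (A : Set (EuclideanSpace ℝ (Fin d))) :
    boxMass x k A ≤
      boxMass x (k + 1) (closedNbhd (dyadicSide d k (Fin.ofNat d k) * δ) A) := by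
  rw [boxMass, boxMass, pow_succ' 2 k, sum_range_two_mul]
  refine Finset.sum_le_sum fun v hv => ?_
  rw [Finset.mem_range] at hv
  have hv1 : 2 * v < 2 ^ (k + 1) := by rw [pow_succ']; omega
  have hv2 : 2 * v + 1 < 2 ^ (k + 1) := by rw [pow_succ']; omega
  have h1 := h.boxCount_pos hn hδ hv1
  have h2 := h.boxCount_pos hn hδ hv2
  have := mul_volume_le_halves (lo := dyadicCorner d k v) (s := dyadicSide d k) (Fin.ofNat d k)
    (γ₁ := 2 ^ k * boxCount x (k + 1) (2 * v)) (γ₂ := 2 ^ k * boxCount x (k + 1) (2 * v + 1))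
    (dyadicSide_pos _ _) (by positivity) (by positivity)
    (mul_le_mul_of_nonneg_left (h.abs_div_sub_half_le hn hδ hv1 hv2 _ (by positivity))
      (dyadicSide_pos _ _).le) A
  rw [boxCount_eq_add x k v, dyadicBox_succ_even, dyadicBox_succ_odd, pow_succ']
  push_cast
  simp only [mul_add, mul_assoc]
  exact this

theorem BalancedAt.boxMass_succ_le {n : ℕ} (hn : 0 < n) {x : Fin n → EuclideanSpace ℝ (Fin d)}
    {k : ℕ} {δ : ℝ} (h : BalancedAt x (k + 1) δ) (hδ : δ ≤ 1 / 2)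
    (A : Set (EuclideanSpace ℝ (Fin d))) :
    boxMass x (k + 1) A ≤
      boxMass x k (closedNbhd (dyadicSide d k (Fin.ofNat d k) * δ) A) := by
  rw [boxMass, boxMass, pow_succ' 2 k, sum_range_two_mul]
  refine Finset.sum_le_sum fun v hv => ?_
  rw [Finset.mem_range] at hv
  have hv1 : 2 * v < 2 ^ (k + 1) := by rw [pow_succ']; omega
  have hv2 : 2 * v + 1 < 2 ^ (k + 1) := by rw [pow_succ']; omega
  have h1 := h.boxCount_pos hn hδ hv1
  have h2 := h.boxCount_pos hn hδ hv2
  have := halves_le_mul_volume (lo := dyadicCorner d k v) (s := dyadicSide d k) (Fin.ofNat d k)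
    (γ₁ := 2 ^ k * boxCount x (k + 1) (2 * v)) (γ₂ := 2 ^ k * boxCount x (k + 1) (2 * v + 1))
    (dyadicSide_pos _ _) (by positivity) (by positivity)
    (mul_le_mul_of_nonneg_left (h.abs_div_sub_half_le hn hδ hv1 hv2 _ (by positivity))
      (dyadicSide_pos _ _).le) A
  rw [boxCount_eq_add x k v, dyadicBox_succ_even, dyadicBox_succ_odd, pow_succ']
  push_cast
  simp only [mul_add, mul_assoc]
  exact this

theorem boxMass_zero_le {n : ℕ} (hn : 0 < n) {x : Fin n → EuclideanSpace ℝ (Fin d)} {m : ℕ}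
    {δ : ℕ → ℝ} (h : ∀ k < m, BalancedAt x (k + 1) (δ k)) (hδ : ∀ k < m, δ k ≤ 1 / 2)
    (A : Set (EuclideanSpace ℝ (Fin d))) :
    boxMass x 0 A ≤ boxMass x m (closedNbhd
      (∑ k ∈ Finset.range m, dyadicSide d k (Fin.ofNat d k) * δ k) A) := by
  induction m with
  | zero =>
    exact boxMass_mono x 0 fun y hy => ⟨y, hy, by simp⟩
  | succ m ih =>
    refine (ih (fun k hk => h k (by omega)) (fun k hk => hδ k (by omega))).trans ?_
    refine ((h m (by omega)).boxMass_le_succ hn (hδ m (by omega)) _).trans ?_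
    rw [Finset.sum_range_succ]
    exact boxMass_mono x _ (closedNbhd_closedNbhd_subset _ _ _)

theorem boxMass_le_zero {n : ℕ} (hn : 0 < n) {x : Fin n → EuclideanSpace ℝ (Fin d)} {m : ℕ}
    {δ : ℕ → ℝ} (h : ∀ k < m, BalancedAt x (k + 1) (δ k)) (hδ : ∀ k < m, δ k ≤ 1 / 2)
    (A : Set (EuclideanSpace ℝ (Fin d))) :
    boxMass x m A ≤ boxMass x 0 (closedNbhd
      (∑ k ∈ Finset.range m, dyadicSide d k (Fin.ofNat d k) * δ k) A) := by
  -- The finest level is undone first, so the induction hypothesis is needed for a neighbourhood of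
  -- `A`.
  induction m generalizing A with
  | zero =>
    exact boxMass_mono x 0 fun y hy => ⟨y, hy, by simp⟩
  | succ m ih =>
    refine ((h m (by omega)).boxMass_succ_le hn (hδ m (by omega)) _).trans ?_
    refine (ih (fun k hk => h k (by omega)) (fun k hk => hδ k (by omega)) _).trans ?_
    rw [Finset.sum_range_succ, add_comm]
    exact boxMass_mono x _ (closedNbhd_closedNbhd_subset _ _ _)

/-- Two samples of `n` points in the unit cube which are balanced over the dyadic boxes of all
levels up to `m` are matched with edges whose length is at most the diameter of the boxes of level
`m`, plus the sum of the displacements needed to correct the imbalances, all of it twice. -/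
theorem bottleneckWeight_le_of_balancedAt {n : ℕ} (hn : 0 < n)
    {x y : Fin n → EuclideanSpace ℝ (Fin d)}
    (hx : ∀ i, x i ∈ dyadicBox d 0 0) (hy : ∀ i, y i ∈ dyadicBox d 0 0) {m : ℕ} {δ : ℕ → ℝ}
    (hbx : ∀ k < m, BalancedAt x (k + 1) (δ k)) (hby : ∀ k < m, BalancedAt y (k + 1) (δ k))
    (hδ : ∀ k < m, δ k ≤ 1 / 2) {t : ℝ} (ht : ∀ i, dyadicSide d m i ≤ t) :
    bottleneckWeight x y ≤
      2 * (d * t + ∑ k ∈ Finset.range m, dyadicSide d k (Fin.ofNat d k) * δ k) := by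
  classical
  set S := ∑ k ∈ Finset.range m, dyadicSide d k (Fin.ofNat d k) * δ k
  -- Hall's condition, by way of level `0`.
  have key (A : Set (EuclideanSpace ℝ (Fin d))) :
      (Finset.univ.filter fun i => x i ∈ A).card ≤
        (Finset.univ.filter fun i => y i ∈ closedNbhd (2 * (d * t + S)) A).card := by
    have hsub : closedNbhd (d * t) (closedNbhd S (closedNbhd S (closedNbhd (d * t) A))) ⊆
        closedNbhd (2 * (d * t + S)) A := by
      refine (closedNbhd_mono (closedNbhd_mono (closedNbhd_closedNbhd_subset _ _ _))).trans ?_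
      refine (closedNbhd_mono (closedNbhd_closedNbhd_subset _ _ _)).trans ?_
      refine (closedNbhd_closedNbhd_subset _ _ _).trans (le_of_eq ?_)
      ring_nf
    rw [← Nat.cast_le (α := ENNReal)]
    calc _ ≤ boxMass x m (closedNbhd (d * t) A) := card_filter_le_boxMass hx A ht
      _ ≤ boxMass x 0 (closedNbhd S (closedNbhd (d * t) A)) := boxMass_le_zero hn hbx hδ _
      _ = boxMass y 0 (closedNbhd S (closedNbhd (d * t) A)) := by
          rw [boxMass_zero hx, boxMass_zero hy]
      _ ≤ boxMass y m (closedNbhd S (closedNbhd S (closedNbhd (d * t) A))) :=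
          boxMass_zero_le hn hby hδ _
      _ ≤ _ := boxMass_le_card_filter hy _ ht
      _ ≤ _ := by
          gcongr with i
  obtain ⟨f, hf, hft⟩ := (Finset.all_card_le_biUnion_card_iff_exists_injective
    (fun i => Finset.univ.filter fun j => dist (x i) (y j) ≤ 2 * (d * t + S))).1 fun s => by
      calc s.card ≤ (Finset.univ.filter fun i => x i ∈ x '' s).card :=
            Finset.card_le_card fun i hi => by
              simpa using ⟨i, hi, rfl⟩
        _ ≤ _ := key _
        _ ≤ _ := Finset.card_le_card fun j hj => by
            obtain ⟨_, ⟨i, hi, rfl⟩, hij⟩ := (Finset.mem_filter.1 hj).2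
            exact Finset.mem_biUnion.2 ⟨i, hi, by simpa using hij⟩
  let φ : Equiv.Perm (Fin n) := Equiv.ofBijective f (Finite.injective_iff_bijective.1 hf)
  have : Nonempty (Fin n) := ⟨⟨0, hn⟩⟩
  refine (ciInf_le (Set.finite_range _).bddBelow φ).trans (ciSup_le fun i => ?_)
  exact (Finset.mem_filter.1 (hft i)).2

end dyadic

/-! ### Chernoff's bound and the probability of imbalance. -/

open Classical in
/-- One half of Chernoff's bound; `t = δ / 2` is the upper tail and `t = -δ / 2` the lower one. -/
theorem measureReal_pi_card_filter_deviation_le_exp {E : Type*} [MeasurableSpace E] (μ : Measure E)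
    [IsProbabilityMeasure μ] {B : Set E} (hB : MeasurableSet B) (n : ℕ) {t : ℝ} (ht : |t| ≤ 1) :
    (Measure.pi fun _ : Fin n => μ).real {x | 2 * t ^ 2 * (n * μ.real B) ≤
      t * ((Finset.univ.filter fun i => x i ∈ B).card - n * μ.real B)} ≤
      Real.exp (-(t ^ 2 * (n * μ.real B))) := by
  set p := μ.real B
  set P := Measure.pi fun _ : Fin n => μ
  -- This is `exp (t * 1_B)`, written as an affine function of the indicator so that its integral is
  -- immediate.
  let g : E → ℝ := fun z => 1 + B.indicator (fun _ => Real.exp t - 1) z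
  have hgi : Integrable (B.indicator fun _ => Real.exp t - 1) μ :=
    (integrable_const _).indicator hB
  have hg : Integrable g μ := (integrable_const 1).add hgi
  have hgint : ∫ z, g z ∂μ = 1 + p * (Real.exp t - 1) := by
    simp only [g]
    rw [integral_add (integrable_const 1) hgi, integral_indicator_const _ hB]
    simp [p]
  have hexp (x : Fin n → E) :
      Real.exp (t * (Finset.univ.filter fun i => x i ∈ B).card) = ∏ i, g (x i) := by
    rw [Finset.card_filter, Nat.cast_sum, Finset.mul_sum, Real.exp_sum]
    refine Finset.prod_congr rfl fun i _ => ?_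
    by_cases hi : x i ∈ B <;> simp [g, hi]
  have hint : Integrable (fun x : Fin n → E => ∏ i, g (x i)) P :=
    Integrable.fintype_prod fun _ => hg
  have hval : ∫ x : Fin n → E, ∏ i, g (x i) ∂P = (1 + p * (Real.exp t - 1)) ^ n := by
    rw [integral_fintype_prod_eq_pow (μ := μ) g, hgint, Fintype.card_fin]
  have hp : 0 ≤ p := measureReal_nonneg
  have hp1 : p ≤ 1 := measureReal_le_one
  -- From `exp t - 1 ≤ t + t ^ 2` for `|t| ≤ 1`, and `1 + u ≤ exp u`.
  have hbound : (1 + p * (Real.exp t - 1)) ^ n ≤ Real.exp (n * p * (t + t ^ 2)) := by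
    have h1 := (abs_le.1 (Real.abs_exp_sub_one_sub_id_le ht)).2
    have h0 := Real.exp_pos t
    calc (1 + p * (Real.exp t - 1)) ^ n ≤ (Real.exp (p * (t + t ^ 2))) ^ n := by
          apply pow_le_pow_left₀
          · nlinarith
          · have := Real.add_one_le_exp (p * (t + t ^ 2))
            nlinarith
      _ = _ := by rw [← Real.exp_nat_mul, mul_assoc]
  have hmarkov := mul_meas_ge_le_integral_of_nonneg (μ := P)
    (ae_of_all _ fun x => (Finset.prod_nonneg fun i _ => by
      by_cases hi : x i ∈ B <;> simp [g, hi, Real.exp_nonneg])) hint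
    (Real.exp (2 * t ^ 2 * (n * p) + t * (n * p)))
  rw [hval] at hmarkov
  have hset : {x : Fin n → E | 2 * t ^ 2 * (n * p) ≤
      t * ((Finset.univ.filter fun i => x i ∈ B).card - n * p)} =
      {x | Real.exp (2 * t ^ 2 * (n * p) + t * (n * p)) ≤ ∏ i, g (x i)} := by
    ext x
    rw [Set.mem_ofPred_eq, Set.mem_ofPred_eq, ← hexp, Real.exp_le_exp, mul_sub, le_sub_iff_add_le]
  rw [hset]
  refine le_of_mul_le_mul_left ((hmarkov.trans hbound).trans (le_of_eq ?_)) (Real.exp_pos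
    (2 * t ^ 2 * (n * p) + t * (n * p)))
  rw [← Real.exp_add]
  ring_nf

open Classical in
/-- Chernoff's bound for the number of points of an i.i.d. sample in a given set. -/
theorem measureReal_pi_abs_card_filter_sub_le_exp {E : Type*} [MeasurableSpace E] (μ : Measure E)
    [IsProbabilityMeasure μ] {B : Set E} (hB : MeasurableSet B) (n : ℕ) {δ : ℝ} (h0 : 0 ≤ δ)
    (h2 : δ ≤ 2) :
    (Measure.pi fun _ : Fin n => μ).real {x | δ * (n * μ.real B) <
      |((Finset.univ.filter fun i => x i ∈ B).card : ℝ) - n * μ.real B|} ≤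
      2 * Real.exp (-(δ ^ 2 / 4 * (n * μ.real B))) := by
  have hu := measureReal_pi_card_filter_deviation_le_exp μ hB n (t := δ / 2)
    (abs_le.2 ⟨by linarith, by linarith⟩)
  have hl := measureReal_pi_card_filter_deviation_le_exp μ hB n (t := -(δ / 2))
    (abs_le.2 ⟨by linarith, by linarith⟩)
  rw [show (δ / 2) ^ 2 = δ ^ 2 / 4 by ring] at hu
  rw [show (-(δ / 2)) ^ 2 = δ ^ 2 / 4 by ring] at hl
  rw [two_mul]
  refine le_trans ?_ (add_le_add hu hl)
  refine (measureReal_mono ?_).trans (measureReal_union_le _ _)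
  intro x hx
  rw [Set.mem_ofPred_eq, lt_abs] at hx
  rcases hx with hx | hx
  · left
    rw [Set.mem_ofPred_eq]
    nlinarith [mul_le_mul_of_nonneg_left hx.le h0]
  · right
    rw [Set.mem_ofPred_eq]
    nlinarith [mul_le_mul_of_nonneg_left hx.le h0]

section dyadic

variable {d : ℕ} [NeZero d]

theorem uniformCube_dyadicBox (k v : ℕ) :
    uniformCube d (dyadicBox d k v) = ENNReal.ofReal ((1 / 2) ^ k) := by
  rw [uniformCube, Measure.restrict_apply (measurableSet_dyadicBox k v), Set.inter_eq_left.2,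
    volume_dyadicBox]
  intro x hx i
  have := dyadicBox_subset k v hx i
  simp only [Set.mem_Ico, zero_add] at this
  exact ⟨this.1, this.2.le⟩

theorem measureReal_uniformCube_dyadicBox (k v : ℕ) :
    (uniformCube d).real (dyadicBox d k v) = (1 / 2) ^ k := by
  rw [measureReal_def, uniformCube_dyadicBox, ENNReal.toReal_ofReal (by positivity)]

/-- The half-open box misses only the upper faces of the cube, a null set. -/
theorem ae_mem_dyadicBox_zero (n : ℕ) :
    ∀ᵐ x ∂(Measure.pi fun _ : Fin n => uniformCube d), ∀ i, x i ∈ dyadicBox d 0 0 := by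
  rw [ae_all_iff]
  intro i
  have h : ∀ᵐ z ∂(uniformCube d), z ∈ dyadicBox d 0 0 :=
    (prob_compl_eq_zero_iff (measurableSet_dyadicBox 0 0)).2 (by rw [uniformCube_dyadicBox]; simp)
  exact (measurePreserving_eval (fun _ : Fin n => uniformCube d) i).quasiMeasurePreserving.ae h

theorem measureReal_not_balancedAt_le (n k : ℕ) {δ : ℝ} (h0 : 0 ≤ δ) (h2 : δ ≤ 2) :
    (Measure.pi fun _ : Fin n => uniformCube d).real {x | ¬ BalancedAt x k δ} ≤
      2 ^ k * (2 * Real.exp (-(δ ^ 2 / 4 * (n / 2 ^ k)))) := by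
  have hsub : {x : Fin n → EuclideanSpace ℝ (Fin d) | ¬ BalancedAt x k δ} ⊆
      ⋃ v ∈ Finset.range (2 ^ k), {x | δ * ((n : ℝ) / 2 ^ k) <
        |(boxCount x k v : ℝ) - (n : ℝ) / 2 ^ k|} := by
    intro x hx
    simp only [BalancedAt, Set.mem_ofPred_eq, not_forall, not_le] at hx
    obtain ⟨v, hv, h⟩ := hx
    exact Set.mem_biUnion (Finset.mem_coe.2 (Finset.mem_range.2 hv)) h
  refine (measureReal_mono hsub (measure_ne_top _ _)).trans ((measureReal_biUnion_finset_le _ _).trans ?_)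
  refine (Finset.sum_le_card_nsmul _ _ (2 * Real.exp (-(δ ^ 2 / 4 * (n / 2 ^ k)))) fun v _ => ?_).trans
    (by simp)
  have := measureReal_pi_abs_card_filter_sub_le_exp (uniformCube d)
    (measurableSet_dyadicBox (d := d) k v) n h0 h2
  rw [measureReal_uniformCube_dyadicBox, one_div, inv_pow, ← div_eq_mul_inv] at this
  exact this

/-- The probability that a uniform sample is not balanced at some level up to `m`, where the
relative error allowed at level `k` is `√(4 L 2 ^ k / n)`. -/
theorem measureReal_exists_not_balancedAt_le {n : ℕ} (hn : 0 < n) (m : ℕ) {L : ℝ} (hL : 0 ≤ L)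
    (hm : m = 0 ∨ 16 * L * 2 ^ m ≤ n) :
    (Measure.pi fun _ : Fin n => uniformCube d).real
      {x | ∃ k < m, ¬ BalancedAt x (k + 1) √(4 * L * 2 ^ (k + 1) / n)} ≤
      4 * 2 ^ m * Real.exp (-L) := by
  have hn' : (0 : ℝ) < n := by exact_mod_cast hn
  have hsub : {x : Fin n → EuclideanSpace ℝ (Fin d) |
      ∃ k < m, ¬ BalancedAt x (k + 1) √(4 * L * 2 ^ (k + 1) / n)} ⊆
      ⋃ k ∈ Finset.range m, {x | ¬ BalancedAt x (k + 1) √(4 * L * 2 ^ (k + 1) / n)} := by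
    rintro x ⟨k, hk, h⟩
    exact Set.mem_biUnion (Finset.mem_coe.2 (Finset.mem_range.2 hk)) h
  refine (measureReal_mono hsub (measure_ne_top _ _)).trans ((measureReal_biUnion_finset_le _ _).trans ?_)
  calc _ ≤ ∑ k ∈ Finset.range m, 4 * Real.exp (-L) * 2 ^ k := by
        refine Finset.sum_le_sum fun k hk => ?_
        rw [Finset.mem_range] at hk
        have hle : (2 : ℝ) ^ (k + 1) ≤ 2 ^ m := pow_le_pow_right₀ one_le_two hk
        have hm' : 16 * L * 2 ^ m ≤ n := hm.resolve_left (by omega)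
        have hδ : √(4 * L * 2 ^ (k + 1) / n) ≤ 2 := by
          rw [Real.sqrt_le_left (by norm_num), div_le_iff₀ hn']
          nlinarith [mul_le_mul_of_nonneg_left hle hL]
        refine (measureReal_not_balancedAt_le n (k + 1) (Real.sqrt_nonneg _) hδ).trans (le_of_eq ?_)
        rw [Real.sq_sqrt (by positivity)]
        -- The tolerance is chosen so that every level has the same Chernoff exponent `L`.
        have : 4 * L * 2 ^ (k + 1) / n / 4 * (n / 2 ^ (k + 1)) = L := by field_simp
        rw [this]
        ring
    _ = 4 * Real.exp (-L) * (2 ^ m - 1) := by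
        rw [← Finset.mul_sum, geom_sum_eq (by norm_num)]
        norm_num
    _ ≤ 4 * 2 ^ m * Real.exp (-L) := by nlinarith [Real.exp_pos (-L)]

end dyadic

/-! ### Choice of the finest level and summation over levels. -/

/-- With `a = n`, the lower bound on `a` keeps the tolerances `√(4 * L * 2 ^ k / n)`, `k ≤ m`, at
most `1 / 2`; the upper bound makes the boxes of level `m` small. If `m = 0` no balance is required.
-/
theorem exists_dyadic_scale {L a : ℝ} (hL : 0 < L) :
    ∃ m : ℕ, (m = 0 ∨ 16 * L * 2 ^ m ≤ a) ∧ a < 32 * L * 2 ^ m := by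
  rcases lt_or_ge a (16 * L) with h | h
  · exact ⟨0, Or.inl rfl, by linarith [pow_zero (2 : ℝ)]⟩
  · obtain ⟨m, h1, h2⟩ := exists_nat_pow_near ((one_le_div (by positivity)).2 h)
      (one_lt_two : (1 : ℝ) < 2)
    rw [le_div_iff₀ (by positivity)] at h1
    rw [div_lt_iff₀ (by positivity), pow_succ] at h2
    exact ⟨m, Or.inr (by linarith), by linarith⟩

/-- A sum with growth ratio at least `11 / 10` is dominated by its next term: `10 + 1 = 10 * (11 /
10)`. -/
theorem sum_range_le_of_mul_le_succ {a : ℕ → ℝ} (h0 : 0 ≤ a 0)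
    (h : ∀ k, 11 / 10 * a k ≤ a (k + 1)) (m : ℕ) :
    ∑ k ∈ Finset.range m, a k ≤ 10 * a m := by
  induction m with
  | zero => simpa using h0
  | succ m ih =>
    rw [Finset.sum_range_succ]
    linarith [h m]

section dyadic

variable {d : ℕ} [NeZero d]

/-- In dimension at least three the displacements which correct the imbalances of all levels add up
to a multiple of the size of the smallest boxes. -/
theorem sum_dyadicSide_mul_sqrt_le (hd : 3 ≤ d) {θ : ℝ} (h0 : 0 ≤ θ) (h1 : θ ≤ 1)
    (hθ : θ ^ d = 1 / 2) {L a : ℝ} (ha : 0 < a) {m : ℕ}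
    (hm : m = 0 ∨ 16 * L * 2 ^ m ≤ a) :
    ∑ k ∈ Finset.range m, dyadicSide d k (Fin.ofNat d k) * √(4 * L * 2 ^ (k + 1) / a) ≤
      20 * θ ^ m := by
  -- Here `d ≥ 3` is decisive: consecutive terms have ratio `θ * √2`, at least `0.79 * 1.4 > 1.1`,
  -- whereas `d = 2` would give `1`.
  have hθ3 : 1 / 2 ≤ θ ^ 3 := hθ ▸ pow_le_pow_of_le_one h0 h1 hd
  have hθ79 : 79 / 100 ≤ θ := by
    by_contra! h
    have : θ ^ 3 ≤ (79 / 100) ^ 3 := by gcongr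
    norm_num at this
    linarith
  have hs : 14 / 10 ≤ √2 := Real.le_sqrt_of_sq_le (by norm_num)
  rcases hm with rfl | hm
  · simp
  have hgeom := sum_range_le_of_mul_le_succ
    (a := fun k => θ ^ k * √(4 * L * 2 ^ (k + 1) / a)) (by positivity) (fun k => by
      have : 4 * L * 2 ^ (k + 1 + 1) / a = 2 * (4 * L * 2 ^ (k + 1) / a) := by ring
      rw [this, Real.sqrt_mul zero_le_two, pow_succ]
      have hX : 0 ≤ θ ^ k * √(4 * L * 2 ^ (k + 1) / a) := by positivity
      have hq : 11 / 10 ≤ θ * √2 := by nlinarith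
      calc _ ≤ θ * √2 * (θ ^ k * √(4 * L * 2 ^ (k + 1) / a)) :=
            mul_le_mul_of_nonneg_right hq hX
        _ = _ := by ring_nf) m
  have hlast : √(4 * L * 2 ^ (m + 1) / a) ≤ 1 := by
    rw [Real.sqrt_le_left zero_le_one, one_pow, div_le_one ha, pow_succ]
    linarith
  calc _ ≤ ∑ k ∈ Finset.range m, 2 * (θ ^ k * √(4 * L * 2 ^ (k + 1) / a)) := by
        refine Finset.sum_le_sum fun k _ => ?_
        rw [← mul_assoc]
        gcongr
        exact dyadicSide_le h0 h1 hθ k _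
    _ ≤ 2 * (10 * (θ ^ m * √(4 * L * 2 ^ (m + 1) / a))) := by
        rw [← Finset.mul_sum]
        linarith
    _ ≤ 20 * θ ^ m := by nlinarith [pow_nonneg h0 m]

theorem bottleneckWeight_le_of_balancedAt_sqrt (hd : 3 ≤ d) {n : ℕ} (hn : 0 < n)
    {x y : Fin n → EuclideanSpace ℝ (Fin d)}
    (hx : ∀ i, x i ∈ dyadicBox d 0 0) (hy : ∀ i, y i ∈ dyadicBox d 0 0) {m : ℕ} {L : ℝ}
    (hL : 0 ≤ L) (hm : m = 0 ∨ 16 * L * 2 ^ m ≤ n) (hm' : n < 32 * L * 2 ^ m)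
    (hbx : ∀ k < m, BalancedAt x (k + 1) √(4 * L * 2 ^ (k + 1) / n))
    (hby : ∀ k < m, BalancedAt y (k + 1) √(4 * L * 2 ^ (k + 1) / n)) :
    bottleneckWeight x y ≤ (4 * d + 40) * (32 * L / n) ^ (1 / (d : ℝ)) := by
  have hn' : (0 : ℝ) < n := by exact_mod_cast hn
  have hd0 : d ≠ 0 := by omega
  set θ : ℝ := (1 / 2) ^ (1 / (d : ℝ))
  have h0 : 0 ≤ θ := by positivity
  have h1 : θ ≤ 1 := Real.rpow_le_one (by norm_num) (by norm_num) (by positivity)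
  have hθ : θ ^ d = 1 / 2 := by
    simp only [θ, one_div (d : ℝ)]
    exact Real.rpow_inv_natCast_pow (by norm_num) hd0
  have hδ : ∀ k < m, √(4 * L * 2 ^ (k + 1) / n) ≤ 1 / 2 := fun k hk => by
    have hle : (2 : ℝ) ^ (k + 1) ≤ 2 ^ m := pow_le_pow_right₀ one_le_two hk
    have := hm.resolve_left (by omega)
    rw [Real.sqrt_le_left (by norm_num), div_le_iff₀ hn']
    nlinarith [mul_le_mul_of_nonneg_left hle hL]
  have hsum := sum_dyadicSide_mul_sqrt_le hd h0 h1 hθ hn' hm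
  have hθm : θ ^ m ≤ (32 * L / n) ^ (1 / (d : ℝ)) := by
    have : θ ^ m = ((1 / 2) ^ m) ^ (1 / (d : ℝ)) := by
      simp only [θ]
      rw [← Real.rpow_natCast, ← Real.rpow_natCast, ← Real.rpow_mul (by norm_num),
        ← Real.rpow_mul (by norm_num), mul_comm]
    rw [this]
    gcongr
    rw [one_div, inv_pow, le_div_iff₀ hn', inv_mul_le_iff₀ (by positivity)]
    linarith
  calc bottleneckWeight x y ≤ 2 * (d * (2 * θ ^ m) + ∑ k ∈ Finset.range m,
        dyadicSide d k (Fin.ofNat d k) * √(4 * L * 2 ^ (k + 1) / n)) :=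
        bottleneckWeight_le_of_balancedAt hn hx hy hbx hby hδ (dyadicSide_le h0 h1 hθ m)
    -- The constant is `2 * (2 * d + 20)`.
    _ ≤ (4 * d + 40) * θ ^ m := by linarith
    _ ≤ _ := by gcongr

theorem measureReal_bottleneckWeight_gt_le (hd : 3 ≤ d) {n : ℕ} (hn : 0 < n) {L : ℝ}
    (hL : 1 / 16 ≤ L) :
    (bipartiteLaw d n).real
      {p | (4 * d + 40) * (32 * L / n) ^ (1 / (d : ℝ)) < bottleneckWeight p.1 p.2} ≤
      8 * n * Real.exp (-L) := by
  have hL0 : 0 ≤ L := by linarith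
  have hn1 : (1 : ℝ) ≤ n := by exact_mod_cast hn
  obtain ⟨m, hm, hm'⟩ := exists_dyadic_scale (L := L) (a := n) (by linarith)
  -- The bound `1 / 16 ≤ L` serves here, to leave at most `n` boxes at level `m`.
  have h2m : (2 : ℝ) ^ m ≤ n := by
    rcases hm with rfl | hm
    · simpa using hn1
    · nlinarith [pow_pos (zero_lt_two (α := ℝ)) m]
  set P := Measure.pi fun _ : Fin n => uniformCube d
  let B : Set (Fin n → EuclideanSpace ℝ (Fin d)) :=
    {x | ¬ ∀ i, x i ∈ dyadicBox d 0 0} ∪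
      {x | ∃ k < m, ¬ BalancedAt x (k + 1) √(4 * L * 2 ^ (k + 1) / n)}
  have hB : P.real B ≤ 4 * n * Real.exp (-L) := by
    refine (measureReal_union_le _ _).trans ?_
    have h : P.real {x | ¬ ∀ i, x i ∈ dyadicBox d 0 0} = 0 := by
      rw [measureReal_def, ae_iff.1 (ae_mem_dyadicBox_zero n), ENNReal.toReal_zero]
    rw [h, zero_add]
    refine (measureReal_exists_not_balancedAt_le hn m hL0 hm).trans ?_
    gcongr
  have hsub : {p : (Fin n → EuclideanSpace ℝ (Fin d)) × (Fin n → EuclideanSpace ℝ (Fin d)) |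
      (4 * d + 40) * (32 * L / n) ^ (1 / (d : ℝ)) < bottleneckWeight p.1 p.2} ⊆
      B ×ˢ Set.univ ∪ Set.univ ×ˢ B := by
    rintro ⟨x, y⟩ hxy
    by_contra h
    simp only [B, Set.mem_union, Set.mem_prod, Set.mem_univ, and_true, true_and, Set.mem_ofPred_eq,
      not_or, not_not, not_exists, not_and] at h
    obtain ⟨⟨hx, hbx⟩, hy, hby⟩ := h
    exact absurd (bottleneckWeight_le_of_balancedAt_sqrt hd hn hx hy hL0 hm hm' hbx hby)
      (not_le.2 hxy)
  refine (measureReal_mono hsub (measure_ne_top _ _)).trans ((measureReal_union_le _ _).trans ?_)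
  rw [bipartiteLaw, measureReal_prod_prod, measureReal_prod_prod, probReal_univ]
  linarith

end dyadic

/-! ### Constants and conclusion. -/

/-- Of the exponent `4 * β ^ 2`, a part `3 * β ^ 2 ≥ 3` absorbs the factor `8`, since `n ≥ 2`. -/
theorem eight_mul_mul_exp_neg_le {n : ℕ} (hn : 2 ≤ n) {β : ℝ} (hβ : 1 ≤ β) :
    8 * n * Real.exp (-(4 * β ^ 2 * Real.log n)) ≤ 1 / (n : ℝ) ^ (β ^ 2 - 1) := by
  have hn2 : (2 : ℝ) ≤ n := by exact_mod_cast hn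
  have hn0 : (0 : ℝ) < n := by linarith
  have h8 : (8 : ℝ) ≤ (n : ℝ) ^ (3 * β ^ 2) := by
    calc (8 : ℝ) = 2 ^ (3 : ℝ) := by norm_num
      _ ≤ (n : ℝ) ^ (3 : ℝ) := by gcongr
      _ ≤ (n : ℝ) ^ (3 * β ^ 2) :=
        Real.rpow_le_rpow_of_exponent_le (by linarith) (by nlinarith)
  have hexp : Real.exp (-(4 * β ^ 2 * Real.log n)) = (n : ℝ) ^ (-(4 * β ^ 2)) := by
    rw [Real.rpow_def_of_pos hn0]
    ring_nf
  calc 8 * n * Real.exp (-(4 * β ^ 2 * Real.log n))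
      ≤ (n : ℝ) ^ (3 * β ^ 2) * n * (n : ℝ) ^ (-(4 * β ^ 2)) := by rw [hexp]; gcongr
    _ = (n : ℝ) ^ (3 * β ^ 2 + 1 + -(4 * β ^ 2)) := by
        rw [Real.rpow_add hn0, Real.rpow_add hn0, Real.rpow_one]
    _ = 1 / (n : ℝ) ^ (β ^ 2 - 1) := by
        rw [one_div, ← Real.rpow_neg hn0.le]
        ring_nf

theorem volume_real_unitBall_pos (d : ℕ) :
    0 < volume.real (Metric.ball (0 : EuclideanSpace ℝ (Fin d)) 1) :=
  ENNReal.toReal_pos (Metric.measure_ball_pos volume _ one_pos).ne' measure_ball_lt_top.ne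

/-- The factor `β ^ 2` of `L` comes out as `β ^ (2 / d) ≤ β`, because `d ≥ 2` and `β ≥ 1`. -/
theorem rpow_le_mul_criticalRadius {d : ℕ} (hd : 2 ≤ d) {n : ℕ} (hn : 1 ≤ n) {β : ℝ}
    (hβ : 1 ≤ β) :
    (32 * (4 * β ^ 2 * Real.log n) / n) ^ (1 / (d : ℝ)) ≤
      (128 * volume.real (Metric.ball (0 : EuclideanSpace ℝ (Fin d)) 1)) ^ (1 / (d : ℝ)) * β *
        criticalRadius d n := by
  set V := volume.real (Metric.ball (0 : EuclideanSpace ℝ (Fin d)) 1) with hV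
  have hV0 : 0 < V := volume_real_unitBall_pos d
  have hn0 : (0 : ℝ) < n := by exact_mod_cast hn
  have hlog : 0 ≤ Real.log n := Real.log_natCast_nonneg n
  have hd2 : (2 : ℝ) ≤ d := by exact_mod_cast hd
  have hscale : 32 * (4 * β ^ 2 * Real.log n) / n =
      128 * V * β ^ 2 * (Real.log n / (V * n)) := by field_simp; ring
  have hβd : (β ^ 2) ^ (1 / (d : ℝ)) ≤ β := by
    calc (β ^ 2) ^ (1 / (d : ℝ)) ≤ (β ^ 2) ^ (1 / (2 : ℝ)) :=
          Real.rpow_le_rpow_of_exponent_le (one_le_pow₀ hβ) (by gcongr)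
      _ = β := by rw [← Real.sqrt_eq_rpow, Real.sqrt_sq (by linarith)]
  rw [hscale, Real.mul_rpow (by positivity) (by positivity),
    Real.mul_rpow (by positivity) (by positivity), criticalRadius, ← hV]
  gcongr

/-- The weight of the bottleneck matching of two independent uniform samples of `n` points in the
unit cube of dimension at least three is of the order of the critical radius. -/
theorem exists_measureReal_bottleneckWeight_gt_le {d : ℕ} (hd : 3 ≤ d) :
    ∃ c : ℝ, 0 < c ∧ ∀ β : ℝ, 1 < β → ∀ n : ℕ, 1 ≤ n →
      (bipartiteLaw d n).real {p | c * β * criticalRadius d n < bottleneckWeight p.1 p.2}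
        ≤ 1 / (n : ℝ) ^ (β ^ 2 - 1) := by
  have : NeZero d := ⟨by omega⟩
  set V := volume.real (Metric.ball (0 : EuclideanSpace ℝ (Fin d)) 1)
  have hV0 : 0 < V := volume_real_unitBall_pos d
  refine ⟨(4 * d + 40) * (128 * V) ^ (1 / (d : ℝ)), by positivity, fun β hβ n hn => ?_⟩
  -- For `n = 1` the claimed bound is `1`.
  rcases hn.eq_or_lt with rfl | hn2
  · simp
  have hn2' : (2 : ℝ) ≤ n := by exact_mod_cast hn2
  have hlog : 1 / 2 ≤ Real.log n :=
    (by linarith [Real.log_two_gt_d9] : 1 / 2 ≤ Real.log 2).trans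
      (Real.log_le_log two_pos hn2')
  refine le_trans (measureReal_mono (fun p hp => ?_) (measure_ne_top _ _))
    ((measureReal_bottleneckWeight_gt_le hd hn (L := 4 * β ^ 2 * Real.log n) (by nlinarith)).trans
      (eight_mul_mul_exp_neg_le hn2 hβ.le))
  rw [Set.mem_ofPred_eq] at hp ⊢
  refine lt_of_le_of_lt ?_ hp
  simpa only [mul_assoc] using mul_le_mul_of_nonneg_left
    (rpow_le_mul_criticalRadius (by omega) hn hβ.le) (by positivity : (0 : ℝ) ≤ 4 * d + 40)

theorem tendsto_measureReal_of_not_le_inv {Ω : ℕ → Type*} [∀ n, MeasurableSpace (Ω n)]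
    (P : ∀ n, Measure (Ω n)) [∀ n, IsProbabilityMeasure (P n)] (S : ∀ n, Set (Ω n)) {s : ℝ}
    (hs : 0 < s) (h : ∀ n : ℕ, 1 ≤ n → (P n).real (S n)ᶜ ≤ 1 / (n : ℝ) ^ s) :
    Tendsto (fun n => (P n).real (S n)) atTop (𝓝 1) := by
  have hlim : Tendsto (fun n : ℕ => 1 - 1 / (n : ℝ) ^ s) atTop (𝓝 1) := by
    have : Tendsto (fun n : ℕ => ((n : ℝ) ^ s)⁻¹) atTop (𝓝 0) :=
      ((tendsto_rpow_atTop hs).comp tendsto_natCast_atTop_atTop).inv_tendsto_atTop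
    simpa using this.const_sub 1
  refine tendsto_of_tendsto_of_tendsto_of_le_of_le' hlim tendsto_const_nhds ?_
    (Eventually.of_forall fun n => measureReal_le_one)
  filter_upwards [eventually_ge_atTop 1] with n hn
  have h1 := measureReal_union_le (μ := P n) (S n) (S n)ᶜ
  rw [Set.union_compl_self, probReal_univ] at h1
  linarith [h n hn]

theorem proposition4p1 (d : ℕ) (hd : 3 ≤ d) :
    (∃ c : ℝ, 0 < c ∧ ∀ β : ℝ, 1 < β → ∀ n : ℕ, 1 ≤ n →
      (bipartiteLaw d n).real {p | c * β * criticalRadius d n < bottleneckWeight p.1 p.2}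
        ≤ 1 / (n : ℝ) ^ (β ^ 2 - 1)) ∧
    (∃ C : ℝ, 0 < C ∧
      Tendsto
        (fun n : ℕ => (bipartiteLaw d n).real
          {p | bottleneckWeight p.1 p.2 ≤ C * criticalRadius d n})
        atTop (𝓝 1)) := by
  have h := exists_measureReal_bottleneckWeight_gt_le hd
  refine ⟨h, ?_⟩
  obtain ⟨c, hc, hP⟩ := h
  refine ⟨c * 2, by positivity, tendsto_measureReal_of_not_le_inv (bipartiteLaw d) _
    (s := 2 ^ 2 - 1) (by norm_num) fun n hn => ?_⟩
  have := hP 2 one_lt_two n hn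
  simpa only [Set.compl_ofPred, not_le] using this
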